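/- Let $I=[0,1]$, let $\mu$ denote Lebesgue measure on $I$ and on $I^2$, and let $\mathcal W_I$ be the set of symmetric Lebesgue measurable functions $W:I^2\to[0,1]$. Let $\Phi_0$ be the set of bijections $\phi:I\to I$ such that $\phi$ and $\phi^{-1}$ are both measurable (with respect to the Lebesgue $\sigma$-algebra on both sides) and measure preserving, and put $W^\phi(x,y)=W(\phi(x),\phi(y))$. For $U,W\in\mathcal W_I$ define $$\delta_\Box(U,W)=\inf_{\phi\in\Phi_0}\|U-W^\phi\|_\Box,\qquad \delta_1(U,W)=\inf_{\phi\in\Phi_0}\|U-W^\phi\|_1,$$ where $\|V\|_\Box=\sup_{S,T}\left|\int_{S\times T}V\,d\mu\right|$, with the supremum over all Lebesgue measurable $S,T\subseteq I$, and $\|V\|_1=\int_{I^2}|V|\,d\mu$. Let $W\in\mathcal W_I$ and let $W_1,W_2,\dots\in\mathcal W_I$ be an arbitrary sequence such that $\delta_\Box(W_n,W)\to0$ as $n\to\infty$. (1) If $\mu(W^{-1}(\{0,1\}))=1$ (that is, $W$ is $\{0,1\}$-valued a.e.), then $\delta_1(W_n,W)\to 0$ as $n\to\infty$. (2) If $\mu(W^{-1}(\{0,1\}))<1$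 and each $W_n$ is a.e. $\{0,1\}$-valued, then the sequence $(W_n)$ has no subsequence that is Cauchy with respect to $\delta_1$. -/

import Mathlib

open Filter Topology MeasureTheory
open scoped unitInterval

noncomputable section

namespace DenseLimit

/- `I = [0,1]` and `I × I` carry their Lebesgue measures `volume`. The Borel sets are Mathlib's
measurable sets there, so the Lebesgue measurable sets are exactly the `NullMeasurableSet`s, and
a function `(I², Lebesgue) → (ℝ, Borel)` is measurable exactly when it is `NullMeasurable`. -/

/-- A graphon: a symmetric bounded Lebesgue measurable function `W : I² → ℝ`. -/
structure IsGraphon (W : I × I → ℝ) : Prop where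
  symm : ∀ x y : I, W (x, y) = W (y, x)
  bounded : ∃ C : ℝ, ∀ z : I × I, |W z| ≤ C
  measurable : NullMeasurable W volume

/-- A graphon with all its values in `[0,1]`. -/
structure IsUnitGraphon (W : I × I → ℝ) : Prop extends IsGraphon W where
  nonneg : ∀ z : I × I, 0 ≤ W z
  le_one : ∀ z : I × I, W z ≤ 1

/-- Measure preserving functions `φ : I → I`, measurable from Lebesgue to Lebesgue sets. -/
structure IsMeasPres (φ : I → I) : Prop where
  nullMeasurableSet_preimage :
    ∀ A : Set I, NullMeasurableSet A volume → NullMeasurableSet (φ ⁻¹' A) volume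
  volume_preimage :
    ∀ A : Set I, NullMeasurableSet A volume → volume (φ ⁻¹' A) = volume A

/-- The set of bijections `φ : I → I` such that both `φ` and `φ⁻¹` are measure preserving. -/
def measPresBij : Set (Equiv.Perm I) :=
  {φ | IsMeasPres φ ∧ IsMeasPres φ.symm}

/-- `W^φ(x, y) = W(φ(x), φ(y))`. -/
def pullback (W : I × I → ℝ) (φ : I → I) : I × I → ℝ :=
  fun z => W (φ z.1, φ z.2)

/-- The `ℓ₁`-norm (used for integrable functions only). -/
def l1Norm (W : I × I → ℝ) : ℝ :=
  ∫ z, |W z|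

/-- The cut norm: the supremum of `|∫_{S × T} W|` over Lebesgue measurable `S, T ⊆ I`
(used for integrable functions only, for which it is the supremum of a bounded set). -/
def cutNorm (W : I × I → ℝ) : ℝ :=
  sSup {r : ℝ | ∃ S T : Set I, NullMeasurableSet S volume ∧ NullMeasurableSet T volume ∧
    r = |∫ z in S ×ˢ T, W z|}

/-- The cut distance `δ_□(U, W)`. -/
def cutDist (U W : I × I → ℝ) : ℝ :=
  sInf {r : ℝ | ∃ φ ∈ measPresBij, r = cutNorm (U - pullback W φ)}

/-- The distance `δ₁(U, W)`. -/
def delta1 (U W : I × I → ℝ) : ℝ :=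
  sInf {r : ℝ | ∃ φ ∈ measPresBij, r = l1Norm (U - pullback W φ)}

/-- A sequence is Cauchy with respect to `δ₁`. -/
def IsDelta1Cauchy (V : ℕ → I × I → ℝ) : Prop :=
  ∀ ε : ℝ, 0 < ε → ∃ N : ℕ, ∀ m n : ℕ, N ≤ m → N ≤ n → delta1 (V m) (V n) < ε

end DenseLimit

end

namespace DenseLimit

/-! If `W` is `{0,1}`-valued and `0 ≤ U ≤ 1`, then `|U - W| = (1 - 2W)(U - W)`: the ℓ₁ distance to
`W` is linear in `U`. Cut-norm convergence to zero of bounded functions forces their integrals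
against any fixed sign function `1 - 2W` to vanish, which gives (1) after the `V n` are aligned to
`W`. For (2), a Cauchy sequence allows later terms to be aligned within `ε` in ℓ₁ of one fixed
`{0,1}`-valued term `v`. With `a` such an aligned term and `w` a copy of `W` close to `a` in cut
norm, `w(1 - w) ≤ |v - w| ≤ |v - a| + (1 - 2v)(w - a)`. The last term integrates to something
vanishing, so `∫ W(1 - W) ≤ ε` for every `ε > 0`. -/

lemma IsMeasPres.aemeasurable {φ : I → I} (hφ : IsMeasPres φ) : AEMeasurable φ volume :=
  NullMeasurable.aemeasurable fun A hA => hφ.nullMeasurableSet_preimage A hA.nullMeasurableSet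

lemma IsMeasPres.map_eq {φ : I → I} (hφ : IsMeasPres φ) :
    (volume : Measure I).map φ = volume := by
  ext A hA
  rw [Measure.map_apply_of_aemeasurable hφ.aemeasurable hA,
    hφ.volume_preimage A hA.nullMeasurableSet]

lemma IsMeasPres.id : IsMeasPres (fun x : I => x) := ⟨fun _ h => h, fun _ _ => rfl⟩

lemma IsMeasPres.comp {φ ψ : I → I} (hφ : IsMeasPres φ) (hψ : IsMeasPres ψ) :
    IsMeasPres (φ ∘ ψ) where
  nullMeasurableSet_preimage A hA :=
    hψ.nullMeasurableSet_preimage _ (hφ.nullMeasurableSet_preimage A hA)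
  volume_preimage A hA := by
    rw [Set.preimage_comp, hψ.volume_preimage _ (hφ.nullMeasurableSet_preimage A hA),
      hφ.volume_preimage A hA]

/-- The map `(x, y) ↦ (φ x, φ y)` is almost everywhere measurable and preserves the measure. -/
lemma IsMeasPres.prodMap {φ : I → I} (hφ : IsMeasPres φ) :
    AEMeasurable (Prod.map φ φ) (volume : Measure (I × I)) ∧
      (volume : Measure (I × I)).map (Prod.map φ φ) = volume := by
  set φ' := hφ.aemeasurable.mk φ with hdef
  have hae : φ =ᵐ[volume] φ' := hφ.aemeasurable.ae_eq_mk
  have hm : Measurable φ' := hφ.aemeasurable.measurable_mk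
  have hmp : MeasurePreserving φ' volume volume :=
    ⟨hm, by rw [← Measure.map_congr hae, hφ.map_eq]⟩
  have hmp2 : MeasurePreserving (Prod.map φ' φ') (volume : Measure (I × I)) volume :=
    hmp.prod hmp
  have hae2 : Prod.map φ φ =ᵐ[(volume : Measure (I × I))] Prod.map φ' φ' := by
    have h1 := Measure.quasiMeasurePreserving_fst
      (μ := (volume : Measure I)) (ν := (volume : Measure I)) |>.ae hae
    have h2 := Measure.quasiMeasurePreserving_snd
      (μ := (volume : Measure I)) (ν := (volume : Measure I)) |>.ae hae
    filter_upwards [h1, h2] with z hz1 hz2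
    simp only [Prod.map, hz1, hz2]
  exact ⟨⟨_, hmp2.measurable, hae2⟩, by rw [Measure.map_congr hae2, hmp2.map_eq]⟩

lemma aemeasurable_pullback {V : I × I → ℝ} (hV : AEMeasurable V volume) {φ : I → I}
    (hφ : IsMeasPres φ) : AEMeasurable (pullback V φ) volume := by
  refine AEMeasurable.comp_aemeasurable (f := Prod.map φ φ) (g := V) ?_ hφ.prodMap.1
  rwa [hφ.prodMap.2]

lemma integral_pullback {V : I × I → ℝ} (hV : AEMeasurable V volume) {φ : I → I}
    (hφ : IsMeasPres φ) : ∫ z, pullback V φ z = ∫ z, V z := by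
  have h := integral_map (μ := (volume : Measure (I × I))) hφ.prodMap.1 (f := V)
    (by rw [hφ.prodMap.2]; exact hV.aestronglyMeasurable)
  rw [hφ.prodMap.2] at h
  exact h.symm

lemma l1Norm_pullback {V : I × I → ℝ} (hV : AEMeasurable V volume) {φ : I → I}
    (hφ : IsMeasPres φ) : l1Norm (pullback V φ) = l1Norm V :=
  integral_pullback (V := fun z => |V z|) (by fun_prop) hφ

lemma integrable_of_abs_le {α : Type*} [MeasurableSpace α] {μ : Measure α} [IsFiniteMeasure μ]
    {V : α → ℝ} {C : ℝ} (hV : AEMeasurable V μ) (hb : ∀ z, |V z| ≤ C) : Integrable V μ :=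
  Integrable.of_bound hV.aestronglyMeasurable C (ae_of_all _ hb)

lemma abs_setIntegral_le {V : I × I → ℝ} {C : ℝ} (hb : ∀ z, |V z| ≤ C) (s : Set (I × I)) :
    |∫ z in s, V z| ≤ C * volume.real s := by
  rw [← Real.norm_eq_abs]
  exact norm_setIntegral_le_of_norm_le_const (measure_lt_top _ _) fun z _ => hb z

/-! ### Cut norm and weak convergence -/

lemma abs_setIntegral_le_cutNorm {V : I × I → ℝ} {C : ℝ} (hb : ∀ z, |V z| ≤ C) {S T : Set I}
    (hS : NullMeasurableSet S volume) (hT : NullMeasurableSet T volume) :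
    |∫ z in S ×ˢ T, V z| ≤ cutNorm V := by
  refine le_csSup ⟨C, ?_⟩ ⟨S, T, hS, hT, rfl⟩
  rintro r ⟨S, T, -, -, rfl⟩
  have hC : 0 ≤ C := (abs_nonneg _).trans (hb (0, 0))
  exact (abs_setIntegral_le hb _).trans (mul_le_of_le_one_right hC measureReal_le_one)

lemma cutNorm_nonneg (V : I × I → ℝ) : 0 ≤ cutNorm V :=
  Real.sSup_nonneg fun _ ⟨_, _, _, _, hr⟩ => hr ▸ abs_nonneg _

lemma cutNorm_neg (V : I × I → ℝ) : cutNorm (-V) = cutNorm V := by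
  simp only [cutNorm, Pi.neg_apply, integral_neg, abs_neg]

/-- A bijection carries rectangles to rectangles, so every test rectangle for the pullback is one
for `V`. -/
lemma cutNorm_pullback_le {V : I × I → ℝ} {C : ℝ} (hV : AEMeasurable V volume)
    (hb : ∀ z, |V z| ≤ C) {φ : Equiv.Perm I} (hφ : φ ∈ measPresBij) :
    cutNorm (pullback V φ) ≤ cutNorm V := by
  refine csSup_le ⟨_, ∅, ∅, .empty, .empty, rfl⟩ ?_
  rintro r ⟨S, T, hS, hT, rfl⟩
  have hS' := hφ.2.nullMeasurableSet_preimage S hS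
  have hT' := hφ.2.nullMeasurableSet_preimage T hT
  have hST : NullMeasurableSet (S ×ˢ T) (volume : Measure (I × I)) := hS.prod hT
  have hST' : NullMeasurableSet ((φ.symm ⁻¹' S) ×ˢ (φ.symm ⁻¹' T))
    (volume : Measure (I × I)) := hS'.prod hT'
  have key : ∫ z in S ×ˢ T, pullback V φ z
      = ∫ z in (φ.symm ⁻¹' S) ×ˢ (φ.symm ⁻¹' T), V z := by
    rw [← integral_indicator₀ hST, ← integral_indicator₀ hST',
      ← integral_pullback (hV.indicator₀ hST') hφ.1]
    congr 1
    ext z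
    by_cases h : z.1 ∈ S ∧ z.2 ∈ T <;> simp [pullback, Set.indicator, Set.mem_prod, h]
  rw [key]
  exact abs_setIntegral_le_cutNorm hb hS' hT'

/-- Convergence to zero in cut norm implies convergence to zero of the integral over any
measurable set. -/
lemma tendsto_setIntegral_of_cutNorm {X : ℕ → I × I → ℝ} {C : ℝ}
    (hX : ∀ n, AEMeasurable (X n) volume) (hb : ∀ n z, |X n z| ≤ C)
    (hlim : Tendsto (fun n => cutNorm (X n)) atTop (𝓝 0)) {s : Set (I × I)}
    (hs : MeasurableSet s) : Tendsto (fun n => ∫ z in s, X n z) atTop (𝓝 0) := by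
  have hint n : Integrable (X n) volume := integrable_of_abs_le (hX n) (hb n)
  have hrect {S T : Set I} (hS : MeasurableSet S) (hT : MeasurableSet T) :
      Tendsto (fun n => ∫ z in S ×ˢ T, X n z) atTop (𝓝 0) :=
    squeeze_zero_norm (fun n => abs_setIntegral_le_cutNorm (hb n) hS.nullMeasurableSet
      hT.nullMeasurableSet) hlim
  have huniv : Tendsto (fun n => ∫ z, X n z) atTop (𝓝 0) := by
    simpa using hrect MeasurableSet.univ MeasurableSet.univ
  -- Dynkin's π-λ argument: rectangles are controlled by the cut norm itself, and disjoint unions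
  -- follow by dominated convergence of series, the uniform bound `C` giving the summable majorant.
  induction s, hs using MeasurableSpace.induction_on_inter generateFrom_prod.symm
    isPiSystem_prod with
  | empty => simp
  | basic s hs =>
    obtain ⟨S, hS, T, hT, rfl⟩ := hs
    exact hrect hS hT
  | compl s hs ih =>
    have h n : ∫ z in sᶜ, X n z = (∫ z, X n z) - ∫ z in s, X n z :=
      setIntegral_compl hs (hint n)
    simpa [h] using huniv.sub ih
  | iUnion f hd hf ih =>
    have h n : ∫ z in ⋃ i, f i, X n z = ∑' i, ∫ z in f i, X n z :=
      integral_iUnion hf hd (hint n).integrableOn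
    have hsum : Summable fun i => C * volume.real (f i) := by
      refine Summable.mul_left C (ENNReal.summable_toReal ?_)
      rw [← measure_iUnion hd hf]
      exact measure_ne_top _ _
    simpa [h] using tendsto_tsum_of_dominated_convergence hsum ih
      (Eventually.of_forall fun n i => abs_setIntegral_le (hb n) (f i))

/-- Convergence to zero in cut norm implies convergence to zero of the integral against `1 - 2U`
for every `{0,1}`-valued `U`. -/
lemma tendsto_integral_sign_mul_of_cutNorm {X : ℕ → I × I → ℝ} {C : ℝ}
    (hX : ∀ n, AEMeasurable (X n) volume) (hb : ∀ n z, |X n z| ≤ C)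
    (hlim : Tendsto (fun n => cutNorm (X n)) atTop (𝓝 0)) {U : I × I → ℝ}
    (hU : AEMeasurable U volume) (h01 : ∀ᵐ z, U z = 0 ∨ U z = 1) :
    Tendsto (fun n => ∫ z, (1 - 2 * U z) * X n z) atTop (𝓝 0) := by
  -- `U` is a.e. the indicator of this measurable set.
  set s : Set (I × I) := hU.mk U ⁻¹' {1}
  have hs : MeasurableSet s := hU.measurable_mk (measurableSet_singleton 1)
  have hint n : Integrable (X n) volume := integrable_of_abs_le (hX n) (hb n)
  have h n : ∫ z, (1 - 2 * U z) * X n z = (∫ z in Set.univ, X n z) - 2 * ∫ z in s, X n z := by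
    rw [setIntegral_univ, ← integral_indicator hs, ← integral_const_mul,
      ← integral_sub (hint n) (((hint n).indicator hs).const_mul 2)]
    refine integral_congr_ae ?_
    filter_upwards [h01, hU.ae_eq_mk] with z hz hmk
    rcases hz with hz | hz
    · have : z ∉ s := by simp [s, ← hmk, hz]
      simp [hz, this]
    · have : z ∈ s := by simp [s, ← hmk, hz]
      simp [hz, this]
      ring
  simpa [h] using (tendsto_setIntegral_of_cutNorm hX hb hlim MeasurableSet.univ).sub
    ((tendsto_setIntegral_of_cutNorm hX hb hlim hs).const_mul 2)

/-! ### Unit graphons and the two distances -/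

lemma IsUnitGraphon.aemeasurable {W : I × I → ℝ} (hW : IsUnitGraphon W) :
    AEMeasurable W volume := hW.measurable.aemeasurable

lemma IsUnitGraphon.abs_sub_le {U W : I × I → ℝ} (hU : IsUnitGraphon U) (hW : IsUnitGraphon W)
    (z w : I × I) : |U z - W w| ≤ 1 := by
  rw [abs_le]
  constructor <;> linarith [hU.nonneg z, hU.le_one z, hW.nonneg w, hW.le_one w]

lemma IsUnitGraphon.integrable {W : I × I → ℝ} (hW : IsUnitGraphon W) : Integrable W volume :=
  integrable_of_abs_le hW.aemeasurable (C := 1) fun z =>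
    abs_le.2 ⟨by linarith [hW.nonneg z], hW.le_one z⟩

lemma IsUnitGraphon.pullback {W : I × I → ℝ} (hW : IsUnitGraphon W) {φ : I → I}
    (hφ : IsMeasPres φ) : IsUnitGraphon (pullback W φ) where
  symm _ _ := hW.symm _ _
  bounded := hW.bounded.imp fun _ h _ => h _
  measurable := (aemeasurable_pullback hW.aemeasurable hφ).nullMeasurable
  nonneg _ := hW.nonneg _
  le_one _ := hW.le_one _

lemma one_mem_measPresBij : (1 : Equiv.Perm I) ∈ measPresBij := ⟨IsMeasPres.id, IsMeasPres.id⟩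

lemma symm_mem_measPresBij {φ : Equiv.Perm I} (hφ : φ ∈ measPresBij) : φ.symm ∈ measPresBij :=
  ⟨hφ.2, hφ.1⟩

lemma exists_cutNorm_lt {U W : I × I → ℝ} {r : ℝ} (h : cutDist U W < r) :
    ∃ φ ∈ measPresBij, cutNorm (U - pullback W φ) < r := by
  obtain ⟨_, ⟨φ, hφ, rfl⟩, hlt⟩ := exists_lt_of_csInf_lt
    (by exact ⟨_, 1, one_mem_measPresBij, rfl⟩) h
  exact ⟨φ, hφ, hlt⟩

lemma exists_l1Norm_lt {U W : I × I → ℝ} {r : ℝ} (h : delta1 U W < r) :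
    ∃ φ ∈ measPresBij, l1Norm (U - pullback W φ) < r := by
  obtain ⟨_, ⟨φ, hφ, rfl⟩, hlt⟩ := exists_lt_of_csInf_lt
    (by exact ⟨_, 1, one_mem_measPresBij, rfl⟩) h
  exact ⟨φ, hφ, hlt⟩

lemma l1Norm_nonneg (V : I × I → ℝ) : 0 ≤ l1Norm V := integral_nonneg fun _ => abs_nonneg _

lemma delta1_nonneg (U W : I × I → ℝ) : 0 ≤ delta1 U W :=
  Real.sInf_nonneg fun _ ⟨_, _, hr⟩ => hr ▸ l1Norm_nonneg _

lemma delta1_le {U W : I × I → ℝ} {φ : Equiv.Perm I} (hφ : φ ∈ measPresBij) :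
    delta1 U W ≤ l1Norm (U - pullback W φ) :=
  csInf_le ⟨0, fun _ ⟨_, _, hr⟩ => hr ▸ l1Norm_nonneg _⟩ ⟨φ, hφ, rfl⟩

/-- Near-optimal measure preserving bijections for a sequence converging in cut distance. -/
lemma exists_seq_tendsto_cutNorm {V : ℕ → I × I → ℝ} {W : I × I → ℝ}
    (hlim : Tendsto (fun n => cutDist (V n) W) atTop (𝓝 0)) :
    ∃ φ : ℕ → Equiv.Perm I, (∀ n, φ n ∈ measPresBij) ∧
      Tendsto (fun n => cutNorm (V n - pullback W (φ n))) atTop (𝓝 0) := by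
  -- The infimum need not be attained, hence a vanishing slack.
  have h n : cutDist (V n) W < cutDist (V n) W + 1 / ((n : ℝ) + 1) :=
    lt_add_of_pos_right _ Nat.one_div_pos_of_nat
  choose φ hφ hlt using fun n => exists_cutNorm_lt (h n)
  refine ⟨φ, hφ, squeeze_zero (fun n => cutNorm_nonneg _) (fun n => (hlt n).le) ?_⟩
  simpa using hlim.add tendsto_one_div_add_atTop_nhds_zero_nat

/-- The sign of `U - W` is dictated by `W` alone: nonnegative where `W = 0`, nonpositive where `W =
1`. -/
lemma l1Norm_sub_eq_of_zero_one {U W : I × I → ℝ} (hU : IsUnitGraphon U)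
    (h01 : ∀ᵐ z, W z = 0 ∨ W z = 1) :
    l1Norm (U - W) = ∫ z, (1 - 2 * W z) * (U - W) z := by
  refine integral_congr_ae ?_
  filter_upwards [h01] with z hz
  simp only [Pi.sub_apply]
  rcases hz with hz | hz <;> rw [hz]
  · rw [abs_of_nonneg] <;> linarith [hU.nonneg z]
  · rw [abs_of_nonpos] <;> linarith [hU.le_one z]

/-- Convergence in cut distance to a `{0,1}`-valued graphon implies convergence in `δ₁`. -/
theorem tendsto_delta1_of_cutDist {V : ℕ → I × I → ℝ} {W : I × I → ℝ}
    (hV : ∀ n, IsUnitGraphon (V n)) (hW : IsUnitGraphon W) (h01 : ∀ᵐ z, W z = 0 ∨ W z = 1)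
    (hlim : Tendsto (fun n => cutDist (V n) W) atTop (𝓝 0)) :
    Tendsto (fun n => delta1 (V n) W) atTop (𝓝 0) := by
  obtain ⟨φ, hφ, hcut⟩ := exists_seq_tendsto_cutNorm hlim
  have hWφ n := hW.pullback (hφ n).1
  have hm n : AEMeasurable (V n - pullback W (φ n)) volume :=
    (hV n).aemeasurable.sub (hWφ n).aemeasurable
  have hb n z : |(V n - pullback W (φ n)) z| ≤ 1 := (hV n).abs_sub_le (hWφ n) z z
  -- The bijection is moved onto `V n` so that the test function `1 - 2W` no longer depends on `n`.
  have hpull n : pullback (V n - pullback W (φ n)) (φ n).symm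
      = pullback (V n) (φ n).symm - W := by
    ext z
    simp [pullback]
  have hcut' : Tendsto (fun n => cutNorm (pullback (V n) (φ n).symm - W)) atTop (𝓝 0) :=
    squeeze_zero (fun n => cutNorm_nonneg _) (fun n => hpull n ▸
      cutNorm_pullback_le (hm n) (hb n) (symm_mem_measPresBij (hφ n))) hcut
  have hVφ n := (hV n).pullback (hφ n).2
  have hmain := tendsto_integral_sign_mul_of_cutNorm
    (fun n => (hVφ n).aemeasurable.sub hW.aemeasurable)
    (fun n z => (hVφ n).abs_sub_le hW z z) hcut' hW.aemeasurable h01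
  refine squeeze_zero (fun n => delta1_nonneg _ _) (fun n => ?_) hmain
  calc delta1 (V n) W ≤ l1Norm (V n - pullback W (φ n)) := delta1_le (hφ n)
    _ = l1Norm (pullback (V n) (φ n).symm - W) := by
      rw [← hpull n, l1Norm_pullback (hm n) (hφ n).2]
    _ = _ := l1Norm_sub_eq_of_zero_one (hVφ n) h01

/-- If `V` is `{0,1}`-valued, Cauchy in `δ₁` and convergent to `W` in cut distance, then `W` is
`{0,1}`-valued. -/
theorem ae_zero_one_of_isDelta1Cauchy {V : ℕ → I × I → ℝ} {W : I × I → ℝ}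
    (hV : ∀ n, IsUnitGraphon (V n)) (hW : IsUnitGraphon W)
    (h01 : ∀ n, ∀ᵐ z, V n z = 0 ∨ V n z = 1)
    (hlim : Tendsto (fun n => cutDist (V n) W) atTop (𝓝 0)) (hC : IsDelta1Cauchy V) :
    ∀ᵐ z, W z = 0 ∨ W z = 1 := by
  have hnn z : 0 ≤ W z * (1 - W z) := mul_nonneg (hW.nonneg z) (by linarith [hW.le_one z])
  have hWm : AEMeasurable (fun z => W z * (1 - W z)) volume :=
    hW.aemeasurable.mul (hW.aemeasurable.const_sub 1)
  have hWb z : |W z * (1 - W z)| ≤ 1 := by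
    rw [abs_of_nonneg (hnn z)]
    exact mul_le_one₀ (hW.le_one z) (by linarith [hW.le_one z]) (by linarith [hW.nonneg z])
  have hle : ∫ z, W z * (1 - W z) ≤ 0 := by
    refine le_of_forall_pos_le_add fun ε hε => ?_
    obtain ⟨N, hN⟩ := hC ε hε
    choose ψ hψ hψlt using fun n => exists_l1Norm_lt (hN N (N + n) le_rfl (Nat.le_add_right N n))
    obtain ⟨χ, hχ, hcut⟩ := exists_seq_tendsto_cutNorm hlim
    -- `χ` aligns `W` to the later term and `ψ` aligns that term to `V N`; the composite brings `W`
    -- into the frame of the fixed `V N`.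
    have hcomp n : IsMeasPres (χ (N + n) ∘ ψ n) := (hχ _).1.comp (hψ n).1
    have hA n := (hV (N + n)).pullback (hψ n).1
    have hB n := hW.pullback (hcomp n)
    have hcut' : Tendsto (fun n => cutNorm (pullback W (χ (N + n) ∘ ψ n)
        - pullback (V (N + n)) (ψ n))) atTop (𝓝 0) := by
      refine squeeze_zero (fun n => cutNorm_nonneg _) (fun n => ?_)
        (hcut.comp (tendsto_add_atTop_nat N))
      have hχW := hW.pullback (hχ (N + n)).1
      have h := cutNorm_pullback_le ((hV (N + n)).aemeasurable.sub hχW.aemeasurable)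
        (fun z => (hV (N + n)).abs_sub_le hχW z z) (hψ n)
      rw [← cutNorm_neg, neg_sub, Function.comp_apply, Nat.add_comm n N]
      exact h
    have hmain := tendsto_integral_sign_mul_of_cutNorm
      (fun n => (hB n).aemeasurable.sub (hA n).aemeasurable)
      (fun n z => (hB n).abs_sub_le (hA n) z z) hcut' (hV N).aemeasurable (h01 N)
    have hbound n : ∫ z, W z * (1 - W z) ≤ ε + ∫ z, (1 - 2 * V N z) *
        (pullback W (χ (N + n) ∘ ψ n) - pullback (V (N + n)) (ψ n)) z := by
      have hsgn : ∀ᵐ z, |1 - 2 * V N z| ≤ 1 := by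
        filter_upwards [h01 N] with z hz
        rcases hz with hz | hz <;> norm_num [hz]
      have hi : Integrable (fun z => (1 - 2 * V N z) *
          (pullback W (χ (N + n) ∘ ψ n) - pullback (V (N + n)) (ψ n)) z) volume :=
        ((hB n).integrable.sub (hA n).integrable).bdd_mul (c := 1)
          (((hV N).aemeasurable.const_mul 2).const_sub 1).aestronglyMeasurable hsgn
      have hi' : Integrable (fun z => |(V N - pullback (V (N + n)) (ψ n)) z|) volume :=
        ((hV N).integrable.sub (hA n).integrable).abs
      calc ∫ z, W z * (1 - W z)
          = ∫ z, pullback (fun z => W z * (1 - W z)) (χ (N + n) ∘ ψ n) z :=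
            (integral_pullback hWm (hcomp n)).symm
        _ ≤ ∫ z, (|(V N - pullback (V (N + n)) (ψ n)) z| + (1 - 2 * V N z) *
              (pullback W (χ (N + n) ∘ ψ n) - pullback (V (N + n)) (ψ n)) z) := by
          refine integral_mono_ae (integrable_of_abs_le (C := 1)
            (aemeasurable_pullback hWm (hcomp n)) fun z => hWb _) (hi'.add hi) ?_
          · filter_upwards [h01 N] with z hz
            have h0 := (hB n).nonneg z
            have h1 := (hB n).le_one z
            change pullback W (χ (N + n) ∘ ψ n) z * (1 - pullback W (χ (N + n) ∘ ψ n) z) ≤ _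
            simp only [Pi.sub_apply]
            have h2 := le_abs_self (V N z - pullback (V (N + n)) (ψ n) z)
            have h3 := neg_abs_le (V N z - pullback (V (N + n)) (ψ n) z)
            -- For `v = V N z`, `w(1 - w)` is at most `w` (case `v = 0`) and at most `1 - w` (case
            -- `v = 1`).
            rcases hz with hz | hz <;> rw [hz] at h2 h3 ⊢ <;> nlinarith
        _ = l1Norm (V N - pullback (V (N + n)) (ψ n)) + _ := integral_add hi' hi
        _ ≤ _ := by
          gcongr
          exact (hψlt n).le
    rw [zero_add]
    simpa using ge_of_tendsto' (hmain.const_add ε) hbound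
  have h0 := (integral_eq_zero_iff_of_nonneg hnn (integrable_of_abs_le (C := 1) hWm hWb)).1
    (le_antisymm hle (integral_nonneg hnn))
  filter_upwards [h0] with z hz
  rcases mul_eq_zero.1 hz with h | h
  · exact Or.inl h
  · exact Or.inr (by linarith)

lemma volume_preimage_zero_one_eq_one_iff {W : I × I → ℝ} (hW : IsUnitGraphon W) :
    volume (W ⁻¹' {0, 1}) = 1 ↔ ∀ᵐ z, W z = 0 ∨ W z = 1 := by
  have hs : NullMeasurableSet (W ⁻¹' {0, 1}) volume :=
    hW.measurable (Set.toFinite {(0 : ℝ), 1}).measurableSet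
  rw [← prob_compl_eq_zero_iff₀ hs]
  rfl

end DenseLimit

theorem mainTheorem4 (W : I × I → ℝ) (hW : DenseLimit.IsUnitGraphon W)
    (Wn : ℕ → I × I → ℝ) (hWn : ∀ n : ℕ, DenseLimit.IsUnitGraphon (Wn n))
    (hlim : Tendsto (fun n => DenseLimit.cutDist (Wn n) W) atTop (𝓝 0)) :
    (volume (W ⁻¹' {0, 1}) = 1 →
      Tendsto (fun n => DenseLimit.delta1 (Wn n) W) atTop (𝓝 0)) ∧
    (volume (W ⁻¹' {0, 1}) < 1 →
      (∀ n : ℕ, ∀ᵐ z : I × I, Wn n z = 0 ∨ Wn n z = 1) →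
      ¬ ∃ k : ℕ → ℕ, StrictMono k ∧ DenseLimit.IsDelta1Cauchy (fun i => Wn (k i))) := by
  refine ⟨fun h => DenseLimit.tendsto_delta1_of_cutDist hWn hW
    ((DenseLimit.volume_preimage_zero_one_eq_one_iff hW).1 h) hlim, ?_⟩
  rintro hlt h01 ⟨k, hk, hC⟩
  exact hlt.ne ((DenseLimit.volume_preimage_zero_one_eq_one_iff hW).2
    (DenseLimit.ae_zero_one_of_isDelta1Cauchy (fun i => hWn (k i)) hW (fun i => h01 (k i))
      (hlim.comp hk.tendsto_atTop) hC))
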